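/- Let $k\ge 1$ and let $\mathbb S^k\subset\mathbb R^{k+1}$ be the unit sphere with its intrinsic distance $d(x,y)=\arccos(x\cdot y)$ and the induced Riemannian metric (tangent vectors are regarded as vectors of $\mathbb R^{k+1}$). Fix $\varepsilon\in(0,\pi/2)$ and let $\mathcal D_\varepsilon=\{x\in\mathbb S^k : d(x,N)<\pi/2-\varepsilon\}$ be the open geodesic disk about the north pole $N=(0,\dots,0,1)$. Let $\mathcal P(\mathcal D_\varepsilon)$ be the set of Borel probability measures on $\mathcal D_\varepsilon$ with the narrow topology, and let $C([0,T);\mathcal P(\mathcal D_\varepsilon))$ be the set of narrowly continuous curves $\rho=(\rho_t)_{t\in[0,T)}$ in it. Let $K(x,y)=g(d(x,y)^2)$ for $x,y\in\mathbb S^k$, where $g:[0,\infty)\to\mathbb R$ is differentiable with locally Lipschitz continuous derivative. For a curve $\rho$ in $\mathcal P(\mathcal D_\varepsilon)$ put $$v[\rho](x,t)=-\int_{\mathcal D_\varepsilon}\nabla_{\mathbb S^k}K_y(x)\,\mathrm d\rho_t(y),\qquad K_y(x)=K(x,y),\quad x\in\mathcal D_\varepsilon,\ t\in[0,T).$$ A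 flow map of $v[\rho]$ on $S\times[0,T)$, with $S\subset\mathcal D_\varepsilon$, is a map $\Psi:S\times[0,T)\to\mathcal D_\varepsilon$, $(x,t)\mapsto\Psi^t(x)$, such that $\Psi^0(x)=x$ and $\frac{\mathrm d}{\mathrm dt}\Psi^t(x)=v[\rho](\Psi^t(x),t)$ for all $x\in S$ and $t\in[0,T)$ (the derivative being one-sided at $t=0$). A curve $\rho$ is a weak solution on $[0,T)$, starting from $\rho_0$, of the aggregation equation $\partial_t\rho-\nabla_{\mathbb S^k}\cdot(\rho\,\nabla_{\mathbb S^k}K*\rho)=0$ if $v[\rho]$ has a unique flow map $\Psi$ on $\operatorname{supp}(\rho_0)\times[0,T)$ and $\rho_t=\Psi^t\#\rho_0$ (push-forward) for all $t\in[0,T)$. **Theorem (well-posedness on the open hemisphere).** Let $\rho_0\in\mathcal P(\mathcal D_\varepsilon)$ have support $\operatorname{supp}(\rho_0)$ compact in $\mathcal D_\varepsilon$. Then there exists $T>0$ such that there is exactly one weak solution, starting from $\rho_0$, among the curves in $C([0,T);\mathcal P(\mathcal D_\varepsilon))$. -/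

import Mathlib

open MeasureTheory Filter Topology Set

noncomputable section

/-- The ambient Euclidean space `ℝ^(k+1)`. -/
abbrev Amb (k : ℕ) : Type := EuclideanSpace ℝ (Fin (k + 1))

/-- The unit sphere `S^k` in `ℝ^(k+1)`. -/
abbrev Sph (k : ℕ) : Type := Metric.sphere (0 : Amb k) 1

/-- The intrinsic (Riemannian) distance on the unit sphere: the angle between `x` and `y`. -/
def sphDist {k : ℕ} (x y : Sph k) : ℝ :=
  Real.arccos (inner ℝ (x : Amb k) (y : Amb k))

/-- The north pole `(0, …, 0, 1)`. -/
def northPole (k : ℕ) : Sph k :=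
  ⟨EuclideanSpace.single (Fin.last k) 1, by simp⟩

/-- The open geodesic disk of radius `π / 2 - ε` centred at the north pole. -/
def polarDisk (k : ℕ) (ε : ℝ) : Set (Sph k) :=
  {x | sphDist x (northPole k) < Real.pi / 2 - ε}

/-- The assumption on the interaction potential: `K(x, y) = g(d(x, y)²)`, where
`g : [0, ∞) → ℝ` is differentiable (one-sidedly at `0`) and its derivative is locally Lipschitz
on `[0, ∞)`. The values of `g` at negative numbers play no role. -/
def IsIntrinsicPotential {k : ℕ} (K : Sph k → Sph k → ℝ) : Prop :=
  ∃ g : ℝ → ℝ, DifferentiableOn ℝ g (Ici 0) ∧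
    LocallyLipschitzOn (Ici 0) (derivWithin g (Ici 0)) ∧
    ∀ x y : Sph k, K x y = g (sphDist x y ^ 2)

/-- `f` is differentiable at the point `x` of the sphere with Riemannian gradient `w`. Tangent
vectors at `x` are the vectors of `ℝ^(k+1)` orthogonal to `x`, with the induced inner product; the
differential of `f` at `x` is `v ↦ ⟪w, v⟫`. -/
def HasSphGradAt {k : ℕ} (f : Sph k → ℝ) (w : Amb k) (x : Sph k) : Prop :=
  inner ℝ w (x : Amb k) = 0 ∧
    (fun y : Sph k => f y - f x - inner ℝ w ((y : Amb k) - x)) =o[𝓝 x]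
      fun y : Sph k => (y : Amb k) - x

open Classical in
/-- The Riemannian gradient at `x` of a function on the sphere (`0` where `f` is not
differentiable), as a vector of `ℝ^(k+1)`. -/
def sphGrad {k : ℕ} (f : Sph k → ℝ) (x : Sph k) : Amb k :=
  if h : ∃ w, HasSphGradAt f w x then h.choose else 0

/-- The Riemannian gradient is unique. -/
theorem HasSphGradAt.unique {k : ℕ} {f : Sph k → ℝ} {w w' : Amb k}
    {x : Sph k} (h : HasSphGradAt f w x) (h' : HasSphGradAt f w' x) : w = w' := by
  by_contra hne
  set u : Amb k := w' - w with hu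
  have hu0 : u ≠ 0 := fun h0 => hne (sub_eq_zero.1 h0).symm
  have hun : 0 < ‖u‖ := norm_pos_iff.2 hu0
  have hux : inner ℝ u (x : Amb k) = 0 := by
    rw [hu, inner_sub_left, h.1, h'.1, sub_zero]
  have hxn : ‖(x : Amb k)‖ = 1 := by simp
  have hxx : inner ℝ (x : Amb k) (x : Amb k) = 1 := by simp [hxn]
  have huu : inner ℝ u u = ‖u‖ ^ 2 := real_inner_self_eq_norm_sq u
  have hxu : inner ℝ (x : Amb k) u = 0 := by rw [real_inner_comm]; exact hux
  have hd := h.2.sub h'.2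
  have hd' : (fun y : Sph k => inner ℝ u ((y : Amb k) - x)) =o[𝓝 x] fun y : Sph k => (y : Amb k) - x := by
    refine hd.congr_left fun y => ?_
    rw [hu, inner_sub_left]; ring
  let c : ℝ → Amb k := fun s => Real.cos s • (x : Amb k) + (Real.sin s * ‖u‖⁻¹) • u
  have hcn : ∀ s, ‖c s‖ ^ 2 = 1 := by
    intro s
    have := Real.sin_sq_add_cos_sq s
    rw [← real_inner_self_eq_norm_sq]
    simp only [c, inner_add_left, inner_add_right, real_inner_smul_left, real_inner_smul_right,
      hxx, huu, hxu, hux]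
    field_simp
    nlinarith
  let y : ℝ → Sph k := fun s => ⟨c s, by
    have := hcn s
    rw [mem_sphere_zero_iff_norm]
    nlinarith [norm_nonneg (c s)]⟩
  have hy0 : y 0 = x := by
    apply Subtype.ext; simp [y, c]
  have hyc : Continuous y := by
    refine Continuous.subtype_mk ?_ _
    simp only [c]; fun_prop
  have hyt : Tendsto y (𝓝 0) (𝓝 x) := by
    have := hyc.tendsto 0
    rwa [hy0] at this
  have he := (hd'.comp_tendsto hyt).def (half_pos hun)
  have hnum : ∀ s, inner ℝ u ((y s : Amb k) - x) = Real.sin s * ‖u‖ := by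
    intro s
    simp only [y, c, inner_sub_right, inner_add_right, real_inner_smul_right, hux, huu]
    field_simp; ring
  have hden : ∀ s, ‖(y s : Amb k) - x‖ ≤ |s| := by
    intro s
    have h1 : ‖(y s : Amb k) - x‖ ^ 2 = 2 - 2 * Real.cos s := by
      rw [norm_sub_sq_real, hxn]
      have h2 : ‖(y s : Amb k)‖ ^ 2 = 1 := hcn s
      rw [h2]
      simp only [y, c, inner_add_left, real_inner_smul_left, hxx, hux]
      ring
    have h3 := Real.one_sub_sq_div_two_le_cos (x := s)
    refine abs_le_of_sq_le_sq' ?_ (abs_nonneg s) |>.2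
    rw [sq_abs, h1]; linarith
  have he2 : ∀ᶠ s in 𝓝 (0 : ℝ), |Real.sin s| ≤ 1 / 2 * |s| := by
    filter_upwards [he] with s hs
    simp only [Function.comp, hnum, Real.norm_eq_abs, abs_mul, abs_of_pos hun] at hs
    have := hden s
    have h4 : |Real.sin s| * ‖u‖ ≤ (‖u‖ / 2) * |s| :=
      hs.trans (mul_le_mul_of_nonneg_left this (by positivity))
    have h5 : |Real.sin s| * ‖u‖ ≤ (1 / 2 * |s|) * ‖u‖ := by linarith
    exact le_of_mul_le_mul_right h5 hun
  have he3 : ∀ᶠ s in 𝓝[>] (0 : ℝ), |Real.sin s| ≤ 1 / 2 * |s| := nhdsWithin_le_nhds he2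
  have he4 : ∀ᶠ s in 𝓝[>] (0 : ℝ), s < 1 := nhdsWithin_le_nhds (Iio_mem_nhds one_pos)
  obtain ⟨s, hs, hs1, hs0⟩ := (he3.and (he4.and self_mem_nhdsWithin)).exists
  have hs0 : 0 < s := hs0
  have := Real.sin_gt_sub_cube hs0
  rw [abs_of_pos hs0] at hs
  have := le_abs_self (Real.sin s)
  nlinarith [mul_pos hs0 hs0]

theorem HasSphGradAt.sphGrad_eq {k : ℕ} {f : Sph k → ℝ} {w : Amb k}
    {x : Sph k} (h : HasSphGradAt f w x) : sphGrad f x = w := by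
  have hex : ∃ w, HasSphGradAt f w x := ⟨w, h⟩
  rw [sphGrad, dif_pos hex]
  exact hex.choose_spec.unique h

/-- The velocity field `v[ρ](x, t) = - ∫ ∇K_y(x) dρ_t(y)`, where `K_y = K(·, y)`. -/
def velocityField {k : ℕ} {ε T : ℝ} (K : Sph k → Sph k → ℝ)
    (ρ : Ico (0 : ℝ) T → ProbabilityMeasure (polarDisk k ε))
    (x : polarDisk k ε) (t : Ico (0 : ℝ) T) : Amb k :=
  -∫ y : polarDisk k ε, sphGrad (fun z => K z y) (x : Sph k) ∂(ρ t : Measure (polarDisk k ε))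

/-- `Ψ` restricted to `S × [0, T)` is a flow map with values in the disk generated by the
time-dependent vector field `X` on the set `S` (the time derivative is one-sided at `t = 0`). The
values of `Ψ` outside `S × [0, T)` play no role. -/
def IsFlowMap {k : ℕ} {ε T : ℝ}
    (X : polarDisk k ε → Ico (0 : ℝ) T → Amb k)
    (S : Set (polarDisk k ε)) (Ψ : polarDisk k ε → ℝ → polarDisk k ε) : Prop :=
  ∀ x ∈ S, Ψ x 0 = x ∧ ∀ t : Ico (0 : ℝ) T,
    HasDerivWithinAt (fun s : ℝ => ((Ψ x s : Sph k) : Amb k))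
      (X (Ψ x t) t) (Ico 0 T) t

/-- `ρ` is a weak (mass-transport) solution on `[0, T)` starting from `ρ₀`: the field `v[ρ]`
generates a unique flow map `Ψ` on `supp ρ₀ × [0, T)`, and `ρ_t` is the push-forward of `ρ₀` by
`Ψ(·, t)` for all `t ∈ [0, T)`. -/
def IsWeakSolution {k : ℕ} {ε T : ℝ} (K : Sph k → Sph k → ℝ)
    (ρ₀ : ProbabilityMeasure (polarDisk k ε))
    (ρ : Ico (0 : ℝ) T → ProbabilityMeasure (polarDisk k ε)) : Prop :=
  ∃ Ψ : polarDisk k ε → ℝ → polarDisk k ε,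
    IsFlowMap (velocityField K ρ) (ρ₀ : Measure (polarDisk k ε)).support Ψ ∧
    (∀ Φ : polarDisk k ε → ℝ → polarDisk k ε,
      IsFlowMap (velocityField K ρ) (ρ₀ : Measure (polarDisk k ε)).support Φ →
        ∀ x ∈ (ρ₀ : Measure (polarDisk k ε)).support, ∀ t ∈ Ico (0 : ℝ) T, Φ x t = Ψ x t) ∧
    ∀ t : Ico (0 : ℝ) T, (ρ t : Measure (polarDisk k ε)) =
      (ρ₀ : Measure (polarDisk k ε)).map (fun x => Ψ x t)

end

/-!
Well-posedness of the aggregation equation on a geodesic disk strictly inside a hemisphere.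

Two points of the disk are uniformly far from being antipodal (`le_inner_diskVec`), so the squared
distance is a regular function of `c = ⟪x, y⟫` there: its derivative in `c` is `-2 θ / sin θ` with
`c = cos θ`, and this is Lipschitz up to `c = 1` (`exists_lipschitzOnWith_angleRatio`). Hence
`-∇K_y(x)` is the ambient field `interaction G x y = -G(⟪x, y⟫) (y - ⟪x, y⟫ x)` with `G` Lipschitz
(`IsIntrinsicPotential.exists_isProfile`), which is Lipschitz in both variables on bounded sets.

In Lagrangian form the equation is an ODE for the flow map itself: if `ρ_t` is the image of `ρ₀`
under `Ψ^t`, then `∂ₜ Ψ^t(x) = ∫ interaction G (Ψ^t x) (Ψ^t y) dρ₀(y)`.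

*Existence.*  The right-hand side is a locally Lipschitz vector field on the Banach space of
continuous maps from the compact support of `ρ₀` to the ambient space, so Picard-Lindelöf applies
(`exists_meanField_flow`). The solution stays on the sphere because the radial component of the
field is proportional to `‖x‖² - 1` (`norm_eq_one_of_hasDerivWithinAt`), and it stays in the disk
for a short time because the support has positive distance from the boundary.

*Uniqueness.*  For two solutions, the difference of the velocities at time `t` is bounded by a
multiple of the supremum over the support of the distance between the two flows at time `t`.
Iterating this estimate gives bounds `B (C t)ⁿ / n!` that tend to zero
(`eq_zero_of_norm_deriv_le_sup`). The same principle gives uniqueness of the flow map for a given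
curve of measures. It needs no regularity of the flow in the initial point, and measurability is
automatic because the push-forward is a probability measure.
-/

noncomputable section

/-! ### The squared angle as a function of the inner product -/

/-- The function `θ / sin θ` of `c = cos θ`, for `c ∈ (-1, 1]`; it extends continuously by `1`
at `c = 1`. -/
def angleRatio (c : ℝ) : ℝ := (Real.sinc (Real.arccos c))⁻¹

theorem sinc_arccos_pos {c : ℝ} (hc : -1 < c) : 0 < Real.sinc (Real.arccos c) := by
  by_cases h : Real.arccos c = 0
  · simp [h]
  · have h0 : 0 < Real.arccos c := lt_of_le_of_ne (Real.arccos_nonneg c) (Ne.symm h)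
    rw [Real.sinc_of_ne_zero h]
    refine div_pos (Real.sin_pos_of_pos_of_lt_pi h0 ?_) h0
    exact lt_of_le_of_ne (Real.arccos_le_pi c) fun h' => by
      rw [Real.arccos_eq_pi] at h'; linarith

theorem continuousOn_angleRatio : ContinuousOn angleRatio (Ioi (-1)) :=
  (Real.continuous_sinc.comp Real.continuous_arccos).continuousOn.inv₀
    fun _ hc => (sinc_arccos_pos hc).ne'

theorem angleRatio_eq {c : ℝ} (hc1 : c < 1) :
    angleRatio c = Real.arccos c / √(1 - c ^ 2) := by
  have h0 : 0 < Real.arccos c := Real.arccos_pos.2 hc1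
  rw [angleRatio, Real.sinc_of_ne_zero h0.ne', Real.sin_arccos, inv_div]

theorem hasDerivAt_arccos_sq {c : ℝ} (hc : -1 < c) (hc1 : c < 1) :
    HasDerivAt (fun c => Real.arccos c ^ 2) (-2 * angleRatio c) c := by
  refine ((Real.hasDerivAt_arccos hc.ne' hc1.ne).pow 2).congr_deriv ?_
  rw [angleRatio_eq hc1]
  simp
  ring

/-- At `c = 1` the derivative is one-sided; it is obtained as the limit of the derivatives. -/
theorem hasDerivWithinAt_arccos_sq {c : ℝ} (hc : -1 < c) (hc1 : c ≤ 1) :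
    HasDerivWithinAt (fun c => Real.arccos c ^ 2) (-2 * angleRatio c) (Iic 1) c := by
  rcases hc1.lt_or_eq with h | rfl
  · exact (hasDerivAt_arccos_sq hc h).hasDerivWithinAt
  · refine hasDerivWithinAt_Iic_of_tendsto_deriv (s := Ioo (-1) 1)
      (fun c hc => (hasDerivAt_arccos_sq hc.1 hc.2).differentiableAt.differentiableWithinAt)
      (by fun_prop) (Ioo_mem_nhdsLT (by norm_num)) ?_
    have h1 : ContinuousAt angleRatio 1 :=
      continuousOn_angleRatio.continuousAt (Ioi_mem_nhds (by norm_num))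
    have h2 : Tendsto (fun c => -2 * angleRatio c) (𝓝[<] 1) (𝓝 (-2 * angleRatio 1)) :=
      (h1.tendsto.const_mul (-2)).mono_left nhdsWithin_le_nhds
    refine h2.congr' ?_
    filter_upwards [Ioo_mem_nhdsLT (show (-1 : ℝ) < 1 by norm_num)] with c hc
    exact (hasDerivAt_arccos_sq hc.1 hc.2).deriv.symm

/-- With `c = cos θ`, the derivative of `θ / sin θ` in `c` is `(θ cos θ - sin θ) / sin³ θ`, and
`|θ cos θ - sin θ| ≤ θ³ / 2`. -/
theorem hasDerivAt_angleRatio {c : ℝ} (hc : -1 < c) (hc1 : c < 1) :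
    ∃ d, HasDerivAt angleRatio d c ∧ |d| ≤ angleRatio c ^ 3 := by
  have hpos : 0 < 1 - c ^ 2 := by nlinarith
  have hs : 0 < √(1 - c ^ 2) := Real.sqrt_pos.2 hpos
  have hss : √(1 - c ^ 2) ^ 2 = 1 - c ^ 2 := Real.sq_sqrt hpos.le
  have h1 : HasDerivAt (fun c : ℝ => 1 - c ^ 2) (-(2 * c)) c := by
    simpa using (hasDerivAt_pow 2 c).const_sub 1
  have h2 := (Real.hasDerivAt_arccos hc.ne' hc1.ne).div (h1.sqrt hpos.ne') hs.ne'
  refine ⟨_, h2.congr_of_eventuallyEq ?_, ?_⟩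
  · filter_upwards [Iio_mem_nhds hc1] with b hb
    exact angleRatio_eq hb
  · rw [angleRatio_eq hc1]
    set θ := Real.arccos c with hθ
    have hθ0 : 0 < θ := Real.arccos_pos.2 hc1
    have hcos : Real.cos θ = c := Real.cos_arccos hc.le hc1.le
    have hsin : Real.sin θ = √(1 - c ^ 2) := Real.sin_arccos c
    have e1 := Real.one_sub_sq_div_two_le_cos (x := θ)
    have e2 := Real.sin_lt hθ0
    have e3 := Real.sin_gt_sub_cube hθ0
    rw [hcos] at e1
    rw [hsin] at e2 e3
    set s := √(1 - c ^ 2) with hsdef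
    have key : (-(1 / s) * s - θ * (-(2 * c) / (2 * s))) / s ^ 2 = (θ * c - s) / s ^ 3 := by
      field_simp
      ring
    rw [key, abs_div, abs_of_pos (pow_pos hs 3), div_pow]
    refine div_le_div_of_nonneg_right ?_ (pow_pos hs 3).le
    have hθ3 : 0 < θ ^ 3 := pow_pos hθ0 3
    rw [abs_le]
    constructor
    · nlinarith [mul_le_mul_of_nonneg_left e1 hθ0.le]
    · nlinarith [mul_le_mul_of_nonneg_left hc1.le hθ0.le]

/-! ### Lipschitz bounds on a compact interval -/

/-- The derivative need not exist at the end points; this covers functions of the angle, which are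
not differentiable in its cosine at `1` from both sides. -/
theorem lipschitzOnWith_Icc_of_hasDerivAt {f : ℝ → ℝ} {a b C : ℝ} (hab : a < b)
    (hf : ContinuousOn f (Icc a b))
    (hf' : ∀ c ∈ Ioo a b, ∃ d, HasDerivAt f d c ∧ |d| ≤ C) :
    LipschitzOnWith C.toNNReal f (Icc a b) := by
  rw [← closure_Ioo hab.ne]
  refine LipschitzOnWith.closure (by rwa [closure_Ioo hab.ne]) ?_
  choose! d hd hdC using hf'
  refine (convex_Ioo a b).lipschitzOnWith_of_nnnorm_hasDerivWithin_le
    (fun c hc => (hd c hc).hasDerivWithinAt) fun c hc => ?_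
  rw [← NNReal.coe_le_coe, coe_nnnorm, Real.norm_eq_abs]
  exact (hdC c hc).trans (Real.le_coe_toNNReal C)

theorem exists_lipschitzOnWith_angleRatio {a : ℝ} (ha : -1 < a) (ha1 : a < 1) :
    ∃ L, LipschitzOnWith L angleRatio (Icc a 1) := by
  have hcont : ContinuousOn angleRatio (Icc a 1) :=
    continuousOn_angleRatio.mono fun c hc => lt_of_lt_of_le ha hc.1
  obtain ⟨C, hC⟩ := isCompact_Icc.exists_bound_of_continuousOn hcont
  refine ⟨_, lipschitzOnWith_Icc_of_hasDerivAt (C := C ^ 3) ha1 hcont fun c hc => ?_⟩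
  obtain ⟨d, hd, hdb⟩ := hasDerivAt_angleRatio (ha.trans hc.1) hc.2
  have h0 : 0 ≤ angleRatio c := (inv_pos.2 (sinc_arccos_pos (ha.trans hc.1))).le
  exact ⟨d, hd, hdb.trans
    (pow_le_pow_left₀ h0 ((le_abs_self _).trans (hC c (Ioo_subset_Icc_self hc))) 3)⟩

theorem exists_lipschitzOnWith_arccos_sq {a : ℝ} (ha : -1 < a) (ha1 : a < 1) :
    ∃ L, LipschitzOnWith L (fun c => Real.arccos c ^ 2) (Icc a 1) := by
  have hcont : ContinuousOn angleRatio (Icc a 1) :=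
    continuousOn_angleRatio.mono fun c hc => lt_of_lt_of_le ha hc.1
  obtain ⟨C, hC⟩ := isCompact_Icc.exists_bound_of_continuousOn hcont
  refine ⟨_, lipschitzOnWith_Icc_of_hasDerivAt (C := 2 * C) ha1 (by fun_prop) fun c hc => ?_⟩
  refine ⟨_, hasDerivAt_arccos_sq (ha.trans hc.1) hc.2, ?_⟩
  have := hC c (Ioo_subset_Icc_self hc)
  rw [Real.norm_eq_abs] at this
  rw [abs_mul]
  norm_num
  linarith

theorem LipschitzOnWith.exists_mul_of_isCompact {α : Type*} [PseudoMetricSpace α]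
    {f g : α → ℝ} {s : Set α} {L M : NNReal} (hs : IsCompact s)
    (hf : LipschitzOnWith L f s) (hg : LipschitzOnWith M g s) :
    ∃ N, LipschitzOnWith N (fun x => f x * g x) s := by
  obtain ⟨A, hA⟩ := hs.exists_bound_of_continuousOn hf.continuousOn
  obtain ⟨B, hB⟩ := hs.exists_bound_of_continuousOn hg.continuousOn
  refine ⟨(A * M + L * B).toNNReal, LipschitzOnWith.of_dist_le_mul fun x hx y hy => ?_⟩
  have h1 := hf.dist_le_mul x hx y hy
  have h2 := hg.dist_le_mul x hx y hy
  rw [Real.dist_eq] at *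
  calc |f x * g x - f y * g y| = |f x * (g x - g y) + (f x - f y) * g y| := by ring_nf
    _ ≤ |f x| * |g x - g y| + |f x - f y| * |g y| := by
        rw [← abs_mul, ← abs_mul]; exact abs_add_le _ _
    _ ≤ A * (M * dist x y) + (L * dist x y) * B := by
        gcongr
        · exact (norm_nonneg _).trans (hA x hx)
        · exact hA x hx
        · exact hB y hy
    _ = (A * M + L * B) * dist x y := by ring
    _ ≤ _ := mul_le_mul_of_nonneg_right (Real.le_coe_toNNReal _) dist_nonneg

/-! ### The gradient of the interaction potential -/

/-- If `f z = h ⟪z, y⟫` on the sphere, then the gradient of `f` is the tangential part of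
`h' ⟪x, y⟫ • y`. The correction along `x` is invisible to first order, because
`⟪x, z - x⟫ = -‖z - x‖² / 2` on the sphere. -/
theorem hasSphGradAt_of_inner {k : ℕ} {h : ℝ → ℝ} {d : ℝ} (x y : Sph k)
    (hh : HasDerivWithinAt h d (Iic 1) (inner ℝ (x : Amb k) (y : Amb k))) :
    HasSphGradAt (fun z : Sph k => h (inner ℝ (z : Amb k) (y : Amb k)))
      (d • ((y : Amb k) - inner ℝ (x : Amb k) (y : Amb k) • (x : Amb k))) x := by
  have hn : ∀ z : Sph k, ‖(z : Amb k)‖ = 1 := fun z => by simp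
  have hxx : inner ℝ (x : Amb k) (x : Amb k) = 1 := by simp
  set c := inner ℝ (x : Amb k) (y : Amb k) with hc
  constructor
  · rw [real_inner_smul_left, inner_sub_left, real_inner_smul_left, hxx, real_inner_comm, ← hc]
    ring
  have hcont : Continuous fun z : Sph k => inner ℝ (z : Amb k) (y : Amb k) := by fun_prop
  have ht : Tendsto (fun z : Sph k => inner ℝ (z : Amb k) (y : Amb k)) (𝓝 x) (𝓝[Iic 1] c) := by
    refine tendsto_nhdsWithin_iff.2 ⟨hcont.tendsto x, Eventually.of_forall fun z => ?_⟩
    have := real_inner_le_norm (z : Amb k) (y : Amb k)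
    rw [hn, hn, one_mul] at this
    exact this
  have h1 := (hasDerivWithinAt_iff_isLittleO.1 hh).comp_tendsto ht
  have h2 : (fun z : Sph k => inner ℝ (z : Amb k) (y : Amb k) - c) =O[𝓝 x]
      fun z : Sph k => (z : Amb k) - x := by
    refine Asymptotics.IsBigO.of_bound 1 (Eventually.of_forall fun z => ?_)
    rw [hc, ← inner_sub_left, one_mul]
    have := norm_inner_le_norm (𝕜 := ℝ) ((z : Amb k) - x) (y : Amb k)
    rwa [hn y, mul_one] at this
  have h3 := h1.trans_isBigO h2
  have hsub : Tendsto (fun z : Sph k => ((z : Amb k) - x)) (𝓝 x) (𝓝 0) := by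
    have : Continuous fun z : Sph k => ((z : Amb k) - x) := by fun_prop
    simpa using this.tendsto x
  have h4 : (fun z : Sph k => ‖(z : Amb k) - x‖ ^ 2) =o[𝓝 x]
      fun z : Sph k => (z : Amb k) - x :=
    (Asymptotics.isLittleO_norm_pow_id (E' := Amb k) (n := 2) one_lt_two).comp_tendsto hsub
  refine (h3.sub (h4.const_mul_left (d * c / 2))).congr_left fun z => ?_
  have e1 : inner ℝ (x : Amb k) ((z : Amb k) - x) = -(‖(z : Amb k) - x‖ ^ 2 / 2) := by
    rw [norm_sub_sq_real, hn, hn, inner_sub_right, hxx, real_inner_comm]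
    ring
  have e2 : inner ℝ (y : Amb k) ((z : Amb k) - x) = inner ℝ (z : Amb k) (y : Amb k) - c := by
    rw [inner_sub_right, real_inner_comm (z : Amb k), real_inner_comm (x : Amb k)]
  rw [real_inner_smul_left, inner_sub_left, real_inner_smul_left, e1, e2]
  simp only [Function.comp, smul_eq_mul]
  ring

/-- As long as `⟪x, y⟫` stays away from `-1`, the gradient of the interaction potential is
`G ⟪x, y⟫ • (y - ⟪x, y⟫ • x)` with a Lipschitz function `G`. -/
theorem IsIntrinsicPotential.exists_lipschitz_profile {k : ℕ} {K : Sph k → Sph k → ℝ}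
    (hK : IsIntrinsicPotential K) {a : ℝ} (ha : -1 < a) (ha1 : a < 1) :
    ∃ (G : ℝ → ℝ) (L : NNReal), LipschitzWith L G ∧ ∀ x y : Sph k,
      a ≤ inner ℝ (x : Amb k) (y : Amb k) →
      sphGrad (fun z => K z y) x = G (inner ℝ (x : Amb k) (y : Amb k)) •
        ((y : Amb k) - inner ℝ (x : Amb k) (y : Amb k) • (x : Amb k)) := by
  obtain ⟨g, hg, hg', hKg⟩ := hK
  -- `F` is the derivative of `c ↦ g (arccos c ^ 2)`, by the chain rule.
  set F : ℝ → ℝ := fun c => derivWithin g (Ici 0) (Real.arccos c ^ 2) * (-2 * angleRatio c)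
    with hF
  obtain ⟨L₁, h₁⟩ := exists_lipschitzOnWith_arccos_sq ha ha1
  obtain ⟨L₂, h₂⟩ := exists_lipschitzOnWith_angleRatio ha ha1
  have hg'' : LocallyLipschitzOn (Icc 0 (Real.pi ^ 2)) (derivWithin g (Ici 0)) :=
    hg'.mono Icc_subset_Ici_self
  obtain ⟨L₃, h₃⟩ := hg''.exists_lipschitzOnWith_of_compact isCompact_Icc
  have hmaps : MapsTo (fun c => Real.arccos c ^ 2) (Icc a 1) (Icc 0 (Real.pi ^ 2)) := fun c _ =>
    ⟨sq_nonneg _, pow_le_pow_left₀ (Real.arccos_nonneg c) (Real.arccos_le_pi c) 2⟩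
  obtain ⟨L, hL⟩ : ∃ L, LipschitzOnWith L F (Icc a 1) :=
    (h₃.comp h₁ hmaps).exists_mul_of_isCompact isCompact_Icc
      ((lipschitzWith_smul (-2 : ℝ)).comp_lipschitzOnWith h₂)
  obtain ⟨G, hG, hFG⟩ := hL.extend_real
  refine ⟨G, L, hG, fun x y hxy => ?_⟩
  have hle : inner ℝ (x : Amb k) (y : Amb k) ≤ 1 := by
    simpa using real_inner_le_norm (x : Amb k) (y : Amb k)
  rw [← hFG ⟨hxy, hle⟩]
  refine HasSphGradAt.sphGrad_eq ?_
  simp only [hKg]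
  refine hasSphGradAt_of_inner (h := fun c => g (Real.arccos c ^ 2)) x y ?_
  have hd := (hg (Real.arccos (inner ℝ (x : Amb k) (y : Amb k)) ^ 2)
    (mem_Ici.2 (sq_nonneg _))).hasDerivWithinAt
  exact HasDerivWithinAt.comp _ hd
    (hasDerivWithinAt_arccos_sq (lt_of_lt_of_le ha hxy) hle) fun c _ => mem_Ici.2 (sq_nonneg _)

/-! ### The interaction field in the ambient space -/

section Interaction

variable {E : Type*} [NormedAddCommGroup E] [InnerProductSpace ℝ E]

/-- The velocity that a unit mass at `y` induces at `x`. It is tangent to the unit sphere at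
points of the sphere, but the formula makes sense for all `x` and `y`. -/
def interaction (G : ℝ → ℝ) (x y : E) : E :=
  -(G (inner ℝ x y) • (y - inner ℝ x y • x))

theorem continuous_interaction {G : ℝ → ℝ} (hG : Continuous G) :
    Continuous fun p : E × E => interaction G p.1 p.2 := by
  unfold interaction
  fun_prop

theorem inner_interaction (G : ℝ → ℝ) (x y : E) :
    inner ℝ x (interaction G x y) =
      G (inner ℝ x y) * inner ℝ x y * (‖x‖ ^ 2 - 1) := by
  rw [interaction, inner_neg_right, real_inner_smul_right, inner_sub_right,
    real_inner_smul_right, real_inner_self_eq_norm_sq]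
  ring

theorem abs_le_of_lipschitzWith {G : ℝ → ℝ} {L : NNReal} (hG : LipschitzWith L G) {c : ℝ}
    (hc : |c| ≤ 4) : |G c| ≤ |G 0| + 4 * L := by
  have h := hG.dist_le_mul c 0
  rw [Real.dist_eq, Real.dist_eq, sub_zero] at h
  have h' := abs_sub_abs_le_abs_sub (G c) (G 0)
  nlinarith [L.coe_nonneg]

/-- On the ball of radius `2` the interaction field is Lipschitz in both variables, and its radial
component is controlled by the distance to the unit sphere. -/
theorem exists_interaction_bound {G : ℝ → ℝ} {L : NNReal} (hG : LipschitzWith L G) :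
    ∃ C : ℝ, 0 ≤ C ∧
      (∀ x y x' y' : E, ‖x‖ ≤ 2 → ‖y‖ ≤ 2 → ‖x'‖ ≤ 2 → ‖y'‖ ≤ 2 →
        ‖interaction G x y - interaction G x' y'‖ ≤ C * (‖x - x'‖ + ‖y - y'‖)) ∧
      ∀ x y : E, ‖x‖ ≤ 2 → ‖y‖ ≤ 2 →
        |inner ℝ x (interaction G x y)| ≤ C * |‖x‖ ^ 2 - 1| := by
  set B : ℝ := |G 0| + 4 * L with hB
  have hB0 : 0 ≤ B := by positivity
  have hL := L.coe_nonneg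
  have hc4 : ∀ x y : E, ‖x‖ ≤ 2 → ‖y‖ ≤ 2 → |inner ℝ x y| ≤ 4 := fun x y hx hy =>
    (abs_real_inner_le_norm x y).trans (by nlinarith [norm_nonneg x, norm_nonneg y])
  refine ⟨9 * B + 20 * L, by positivity, fun x y x' y' hx hy hx' hy' => ?_, fun x y hx hy => ?_⟩
  · set c := inner ℝ x y with hc
    set c' := inner ℝ x' y' with hc'
    set D := ‖x - x'‖ + ‖y - y'‖ with hD
    have hxx := norm_nonneg (x - x')
    have hyy := norm_nonneg (y - y')
    have h1 : |c| ≤ 4 := hc4 x y hx hy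
    have h2 : |c'| ≤ 4 := hc4 x' y' hx' hy'
    have h3 : |c - c'| ≤ 2 * D := by
      have e : c - c' = inner ℝ (x - x') y + inner ℝ x' (y - y') := by
        rw [hc, hc', inner_sub_left, inner_sub_right]; ring
      have e1 := abs_real_inner_le_norm (x - x') y
      have e2 := abs_real_inner_le_norm x' (y - y')
      rw [e]
      refine (abs_add_le _ _).trans ?_
      nlinarith
    have h4 : ‖(y - c • x) - (y' - c' • x')‖ ≤ 9 * D := by
      have e : (y - c • x) - (y' - c' • x') = (y - y') - c • (x - x') - (c - c') • x' := by
        module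
      rw [e]
      refine (norm_sub_le _ _).trans ?_
      refine (add_le_add_left (norm_sub_le _ _) _).trans ?_
      rw [norm_smul, norm_smul, Real.norm_eq_abs, Real.norm_eq_abs]
      nlinarith [abs_nonneg (c - c'), norm_nonneg x']
    have h5 : ‖y' - c' • x'‖ ≤ 10 := by
      refine (norm_sub_le _ _).trans ?_
      rw [norm_smul, Real.norm_eq_abs]
      nlinarith [norm_nonneg x', abs_nonneg c']
    have h6 : |G c - G c'| ≤ L * (2 * D) := by
      have := hG.dist_le_mul c c'
      rw [Real.dist_eq, Real.dist_eq] at this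
      exact this.trans (mul_le_mul_of_nonneg_left h3 hL)
    have e : interaction G x y - interaction G x' y' =
        -(G c • ((y - c • x) - (y' - c' • x')) + (G c - G c') • (y' - c' • x')) := by
      simp only [interaction, ← hc, ← hc']
      module
    rw [e, norm_neg]
    refine (norm_add_le _ _).trans ?_
    rw [norm_smul, norm_smul, Real.norm_eq_abs, Real.norm_eq_abs]
    calc |G c| * ‖(y - c • x) - (y' - c' • x')‖ + |G c - G c'| * ‖y' - c' • x'‖
        ≤ B * (9 * D) + L * (2 * D) * 10 := by
          gcongr
          exact abs_le_of_lipschitzWith hG h1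
      _ = (9 * B + 20 * L) * D := by ring
  · have h1 := hc4 x y hx hy
    have h2 := abs_le_of_lipschitzWith hG h1
    rw [inner_interaction, abs_mul, abs_mul]
    refine mul_le_mul_of_nonneg_right ?_ (abs_nonneg _)
    nlinarith [abs_nonneg (G (inner ℝ x y)), abs_nonneg (inner ℝ x y)]

end Interaction

/-! ### A uniqueness principle for coupled families of curves -/

/-- A uniformly bounded family of curves starting at `0` vanishes if the derivatives at time `t`
are bounded by a constant times the supremum of the family at time `t`: integrating the bound `B`
repeatedly gives `‖f i t‖ ≤ B (C t) ^ n / n!`. No continuity in the index `i` is needed. -/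
theorem eq_zero_of_norm_deriv_le_sup {ι E : Type*} [NormedAddCommGroup E] [NormedSpace ℝ E]
    {f f' : ι → ℝ → E} {T B C : ℝ} (h0 : ∀ i, f i 0 = 0)
    (hB : ∀ i, ∀ t ∈ Ico 0 T, ‖f i t‖ ≤ B)
    (hf : ∀ i, ∀ t ∈ Ico 0 T, HasDerivWithinAt (f i) (f' i t) (Ico 0 T) t)
    (hf' : ∀ t ∈ Ico 0 T, ∀ b, (∀ i, ‖f i t‖ ≤ b) → ∀ i, ‖f' i t‖ ≤ C * b) :
    ∀ i, ∀ t ∈ Ico 0 T, f i t = 0 := by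
  have key : ∀ n : ℕ, ∀ i, ∀ t ∈ Ico 0 T, ‖f i t‖ ≤ B * ((C * t) ^ n / n.factorial) := by
    intro n
    induction n with
    | zero => simpa using hB
    | succ n ih =>
      intro i t ht
      have hsub : Icc 0 t ⊆ Ico 0 T := fun s hs => ⟨hs.1, hs.2.trans_lt ht.2⟩
      have hder : ∀ s, HasDerivAt
          (fun s => B * ((C * s) ^ (n + 1) / (n + 1).factorial))
          (C * (B * ((C * s) ^ n / n.factorial))) s := by
        intro s
        have h1 : HasDerivAt (fun s => C * s) C s := by
          simpa using (hasDerivAt_id s).const_mul C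
        refine (((h1.pow (n + 1)).div_const _).const_mul B).congr_deriv ?_
        have : (n.factorial : ℝ) ≠ 0 := by positivity
        rw [Nat.factorial_succ]
        push_cast
        field_simp
      refine image_norm_le_of_norm_deriv_right_le_deriv_boundary (f' := f' i)
        (a := 0) (b := t)
        (fun s hs => ((hf i s (hsub hs)).mono hsub).continuousWithinAt) (fun s hs => ?_) ?_ hder
        (fun s hs => ?_) ⟨ht.1, le_rfl⟩
      · have hs' := hsub (Ico_subset_Icc_self hs)
        refine (hf i s hs').mono_of_mem_nhdsWithin ?_
        exact mem_of_superset (Ico_mem_nhdsGE hs'.2) (Ico_subset_Ico_left hs'.1)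
      · simp [h0]
      · have hs' := hsub (Ico_subset_Icc_self hs)
        exact hf' s hs' _ (fun j => ih j s hs') i
  intro i t ht
  have hlim : Tendsto (fun n : ℕ => B * ((C * t) ^ n / n.factorial)) atTop (𝓝 (B * 0)) :=
    (FloorSemiring.tendsto_pow_div_factorial_atTop (C * t)).const_mul B
  rw [mul_zero] at hlim
  exact norm_le_zero_iff.1 (ge_of_tendsto' hlim fun n => key n i t ht)

/-! ### Existence for the Lagrangian equation -/

section Lagrangian

variable {E : Type*} [NormedAddCommGroup E] [NormedSpace ℝ E] [FiniteDimensional ℝ E]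
  {S : Type*} [MetricSpace S] [CompactSpace S] [MeasurableSpace S] [BorelSpace S]

theorem continuous_meanField (μ : Measure S) [IsProbabilityMeasure μ] {V : E → E → E}
    (hV : Continuous fun p : E × E => V p.1 p.2) (X : C(S, E)) :
    Continuous fun x => ∫ y, V (X x) (X y) ∂μ := by
  have hc : Continuous fun p : S × S => V (X p.1) (X p.2) :=
    hV.comp ((X.continuous.comp continuous_fst).prodMk (X.continuous.comp continuous_snd))
  obtain ⟨B, hB⟩ := isCompact_univ.exists_bound_of_continuousOn hc.continuousOn
  refine continuous_of_dominated (bound := fun _ => B)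
    (fun x => (hc.comp (Continuous.prodMk_right x)).aestronglyMeasurable)
    (fun x => Eventually.of_forall fun y => hB (x, y) (mem_univ _)) (integrable_const B)
    (Eventually.of_forall fun y => hc.comp (Continuous.prodMk_left y))

/-- The vector field on the Banach space `C(S, E)` of particle configurations, in which the
particle `x` moves with the average over `y` of the velocities `V (X x) (X y)`. -/
def meanField (μ : Measure S) [IsProbabilityMeasure μ] (V : E → E → E)
    (hV : Continuous fun p : E × E => V p.1 p.2) (X : C(S, E)) : C(S, E) :=
  ⟨fun x => ∫ y, V (X x) (X y) ∂μ, continuous_meanField μ hV X⟩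

theorem integrable_meanField (μ : Measure S) [IsProbabilityMeasure μ] {V : E → E → E}
    (hV : Continuous fun p : E × E => V p.1 p.2) (X : C(S, E)) (x : S) :
    Integrable (fun y => V (X x) (X y)) μ := by
  have hc : Continuous fun y : S => V (X x) (X y) :=
    hV.comp (continuous_const.prodMk X.continuous)
  obtain ⟨B, hB⟩ := isCompact_univ.exists_bound_of_continuousOn hc.continuousOn
  exact Integrable.of_bound hc.aestronglyMeasurable B
    (Eventually.of_forall fun y => hB y (mem_univ _))

/-- Short-time existence of the flow of particles, by the Picard-Lindelöf theorem in `C(S, E)`. -/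
theorem exists_meanField_flow (μ : Measure S) [IsProbabilityMeasure μ] {V : E → E → E}
    (hV : Continuous fun p : E × E => V p.1 p.2) {C : ℝ} (hC : 0 ≤ C)
    (hVC : ∀ x y x' y' : E, ‖x‖ ≤ 2 → ‖y‖ ≤ 2 → ‖x'‖ ≤ 2 → ‖y'‖ ≤ 2 →
        ‖V x y - V x' y'‖ ≤ C * (‖x - x'‖ + ‖y - y'‖))
    (X₀ : C(S, E)) (hX₀ : ∀ x, ‖X₀ x‖ ≤ 1) {η : ℝ} (hη : 0 < η) :
    ∃ T : ℝ, 0 < T ∧ ∃ X : ℝ → C(S, E), X 0 = X₀ ∧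
      (∀ t ∈ Ico 0 T, ∀ x, ‖X t x - X₀ x‖ < η) ∧
      ∀ t ∈ Ico 0 T, ∀ x, HasDerivWithinAt (fun s => X s x)
        (∫ y, V (X t x) (X t y) ∂μ) (Ico 0 T) t := by
  have hX₀n : ‖X₀‖ ≤ 1 := (ContinuousMap.norm_le _ zero_le_one).2 hX₀
  have hball : ∀ X ∈ Metric.closedBall X₀ ((1 : NNReal) : ℝ), ∀ x, ‖X x‖ ≤ 2 := by
    intro X hX x
    have h1 := mem_closedBall_iff_norm.1 hX
    have h2 := norm_le_norm_add_norm_sub X₀ X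
    have h3 := X.norm_coe_le_norm x
    rw [norm_sub_rev] at h2
    push_cast at h1
    linarith
  have hlip : LipschitzOnWith (2 * C).toNNReal (meanField μ V hV)
      (Metric.closedBall X₀ ((1 : NNReal) : ℝ)) := by
    refine LipschitzOnWith.of_dist_le_mul fun X hX Y hY => ?_
    rw [Real.coe_toNNReal _ (by positivity), dist_eq_norm, dist_eq_norm]
    refine (ContinuousMap.norm_le _ (by positivity)).2 fun x => ?_
    change ‖(∫ y, V (X x) (X y) ∂μ) - ∫ y, V (Y x) (Y y) ∂μ‖ ≤ _
    rw [← integral_sub (integrable_meanField μ hV X x) (integrable_meanField μ hV Y x)]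
    refine (norm_integral_le_of_norm_le_const (C := 2 * C * ‖X - Y‖)
      (Eventually.of_forall fun y => ?_)).trans (by simp)
    refine (hVC _ _ _ _ (hball X hX x) (hball X hX y) (hball Y hY x) (hball Y hY y)).trans ?_
    have h1 := (X - Y).norm_coe_le_norm x
    have h2 := (X - Y).norm_coe_le_norm y
    rw [ContinuousMap.sub_apply] at h1 h2
    nlinarith
  set M : NNReal := ‖meanField μ V hV X₀‖₊ + (2 * C).toNNReal with hM
  have hbd : ∀ X ∈ Metric.closedBall X₀ ((1 : NNReal) : ℝ), ‖meanField μ V hV X‖ ≤ M := by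
    intro X hX
    have h1 := hlip.dist_le_mul X hX X₀ (Metric.mem_closedBall_self (by simp))
    have h2 := mem_closedBall_iff_norm.1 hX
    have h3 := norm_le_norm_add_norm_sub (meanField μ V hV X₀) (meanField μ V hV X)
    rw [dist_eq_norm, dist_eq_norm] at h1
    rw [norm_sub_rev] at h3
    rw [hM]
    push_cast at h1 h2 ⊢
    nlinarith [NNReal.coe_nonneg (2 * C).toNNReal, Real.coe_toNNReal' (2 * C)]
  set τ : ℝ := 1 / (M + 1) with hτ
  have hτ0 : 0 < τ := by positivity
  have hPL : IsPicardLindelof (fun _ => meanField μ V hV) (tmin := 0) (tmax := τ)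
      ⟨0, le_rfl, hτ0.le⟩ X₀ 1 0 M (2 * C).toNNReal := by
    refine IsPicardLindelof.of_time_independent hbd hlip ?_
    simp only [sub_zero, NNReal.coe_one, NNReal.coe_zero, sub_self]
    rw [max_eq_left hτ0.le, hτ, mul_one_div, div_le_one (by positivity)]
    linarith
  obtain ⟨X, hX0, hX⟩ := hPL.exists_eq_forall_mem_Icc_hasDerivWithinAt₀
  simp only at hX0
  have hcont : ContinuousWithinAt X (Icc 0 τ) 0 := (hX 0 ⟨le_rfl, hτ0.le⟩).continuousWithinAt
  -- The solution stays near `X₀` for a short time, by continuity.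
  have hnear : ∀ᶠ t in 𝓝[≥] (0 : ℝ), dist (X t) X₀ < η := by
    have h1 : ContinuousWithinAt X (Ici 0) 0 :=
      hcont.mono_of_mem_nhdsWithin (Icc_mem_nhdsGE hτ0)
    have h2 : Tendsto X (𝓝[≥] 0) (𝓝 X₀) := by
      have := h1.tendsto
      rwa [hX0] at this
    exact h2 (Metric.ball_mem_nhds X₀ hη)
  obtain ⟨σ, hσ0, hσ⟩ := mem_nhdsGE_iff_exists_Ico_subset.1 hnear
  have hσ0 : 0 < σ := hσ0
  refine ⟨min σ τ, lt_min hσ0 hτ0, X, hX0, fun t ht x => ?_, fun t ht x => ?_⟩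
  · have h1 : dist (X t) X₀ < η := hσ ⟨ht.1, ht.2.trans_le (min_le_left _ _)⟩
    rw [dist_eq_norm] at h1
    exact ((X t - X₀).norm_coe_le_norm x).trans_lt h1
  · have hsub : Ico 0 (min σ τ) ⊆ Icc 0 τ := fun s hs =>
      ⟨hs.1, (hs.2.trans_le (min_le_right _ _)).le⟩
    exact ((ContinuousMap.evalCLM ℝ x).hasFDerivAt.comp_hasDerivWithinAt t
      (hX t (hsub ht))).mono hsub

end Lagrangian

/-! ### Geometry of the disk -/

/-- A point of the disk as a vector of the ambient space. -/
abbrev diskVec {k : ℕ} {ε : ℝ} (x : polarDisk k ε) : Amb k := ((x : Sph k) : Amb k)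

theorem norm_diskVec {k : ℕ} {ε : ℝ} (x : polarDisk k ε) : ‖diskVec x‖ = 1 := by simp

theorem continuous_diskVec {k : ℕ} {ε : ℝ} :
    Continuous (diskVec : polarDisk k ε → Amb k) :=
  continuous_subtype_val.comp continuous_subtype_val

theorem mem_polarDisk_iff {k : ℕ} {ε : ℝ} (hε : 0 < ε) (hε' : ε < Real.pi / 2) (x : Sph k) :
    x ∈ polarDisk k ε ↔ Real.sin ε < inner ℝ (x : Amb k) (northPole k : Amb k) := by
  have h1 : |inner ℝ (x : Amb k) (northPole k : Amb k)| ≤ 1 := by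
    simpa using abs_real_inner_le_norm (x : Amb k) (northPole k : Amb k)
  have h2 : Real.arccos (Real.sin ε) = Real.pi / 2 - ε := by
    rw [← Real.cos_pi_div_two_sub, Real.arccos_cos] <;> linarith
  change Real.arccos _ < _ ↔ _
  rw [← h2]
  exact Real.strictAntiOn_arccos.lt_iff_gt (abs_le.1 h1)
    ⟨Real.neg_one_le_sin ε, Real.sin_le_one ε⟩

/-- Two points of the disk are not antipodal, uniformly: test `x + y` against the pole. -/
theorem le_inner_diskVec {k : ℕ} {ε : ℝ} (hε : 0 < ε) (hε' : ε < Real.pi / 2)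
    (x y : polarDisk k ε) : 2 * Real.sin ε ^ 2 - 1 ≤ inner ℝ (diskVec x) (diskVec y) := by
  have hx : Real.sin ε < inner ℝ (diskVec x) (northPole k : Amb k) :=
    (mem_polarDisk_iff hε hε' x.1).1 (Subtype.prop x)
  have hy : Real.sin ε < inner ℝ (diskVec y) (northPole k : Amb k) :=
    (mem_polarDisk_iff hε hε' y.1).1 (Subtype.prop y)
  have hs : 0 < Real.sin ε := Real.sin_pos_of_pos_of_lt_pi hε (by linarith)
  have h1 : 2 * Real.sin ε ≤ ‖diskVec x + diskVec y‖ := by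
    have h := real_inner_le_norm (diskVec x + diskVec y) (northPole k : Amb k)
    rw [inner_add_left, norm_eq_of_mem_sphere, mul_one] at h
    linarith
  have h2 : ‖diskVec x + diskVec y‖ ^ 2 = 2 + 2 * inner ℝ (diskVec x) (diskVec y) := by
    rw [norm_add_sq_real, norm_diskVec x, norm_diskVec y]
    ring
  nlinarith

/-! ### The velocity field -/

/-- `G` is a profile of the potential `K`: on the disk, the negative gradient of `K` is the
interaction field of `G`. -/
def IsProfile {k : ℕ} (ε : ℝ) (K : Sph k → Sph k → ℝ) (G : ℝ → ℝ) : Prop :=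
  ∀ x y : polarDisk k ε,
    -sphGrad (fun z => K z y) (x : Sph k) = interaction G (diskVec x) (diskVec y)

theorem IsIntrinsicPotential.exists_isProfile {k : ℕ} {ε : ℝ} (hε : 0 < ε)
    (hε' : ε < Real.pi / 2) {K : Sph k → Sph k → ℝ} (hK : IsIntrinsicPotential K) :
    ∃ (G : ℝ → ℝ) (L : NNReal), LipschitzWith L G ∧ IsProfile ε K G := by
  have hs : 0 < Real.sin ε := Real.sin_pos_of_pos_of_lt_pi hε (by linarith)
  have hs1 : Real.sin ε < 1 := by
    rw [← Real.sin_pi_div_two]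
    exact Real.sin_lt_sin_of_lt_of_le_pi_div_two (by linarith) le_rfl hε'
  obtain ⟨G, L, hG, h⟩ := hK.exists_lipschitz_profile
    (a := 2 * Real.sin ε ^ 2 - 1) (by nlinarith) (by nlinarith)
  exact ⟨G, L, hG, fun x y => by rw [h x y (le_inner_diskVec hε hε' x y), interaction]⟩

theorem velocityField_eq {k : ℕ} {ε T : ℝ} {K : Sph k → Sph k → ℝ} {G : ℝ → ℝ}
    (hG : IsProfile ε K G) (ρ : Ico (0 : ℝ) T → ProbabilityMeasure (polarDisk k ε))
    (x : polarDisk k ε) (t : Ico (0 : ℝ) T) :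
    velocityField K ρ x t =
      ∫ y : polarDisk k ε,
        interaction G (diskVec x) (diskVec y) ∂(ρ t : Measure (polarDisk k ε)) := by
  rw [velocityField, ← integral_neg]
  exact integral_congr_ae (Eventually.of_forall fun y => hG x y)

theorem continuous_interaction_diskVec {k : ℕ} {ε : ℝ} {G : ℝ → ℝ} (hG : Continuous G)
    (x : polarDisk k ε) :
    Continuous fun y : polarDisk k ε => interaction G (diskVec x) (diskVec y) :=
  (continuous_interaction hG).comp (continuous_const.prodMk continuous_diskVec)

/-- The change of variables that turns the field of a transported measure into an average over the
initial particles. -/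
theorem velocityField_eq_of_map {k : ℕ} {ε T : ℝ} {K : Sph k → Sph k → ℝ} {G : ℝ → ℝ}
    (hG : IsProfile ε K G) (hGc : Continuous G)
    {ρ : Ico (0 : ℝ) T → ProbabilityMeasure (polarDisk k ε)} {t : Ico (0 : ℝ) T}
    {μ : Measure (polarDisk k ε)} {ψ : polarDisk k ε → polarDisk k ε} (hψ : AEMeasurable ψ μ)
    (hρ : (ρ t : Measure (polarDisk k ε)) = μ.map ψ) (x : polarDisk k ε) :
    velocityField K ρ x t = ∫ y, interaction G (diskVec x) (diskVec (ψ y)) ∂μ := by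
  rw [velocityField_eq hG, hρ,
    integral_map hψ (continuous_interaction_diskVec hGc x).aestronglyMeasurable]

/-- If the image of a measure is a probability measure, the map was measurable: otherwise the
image is zero by convention. -/
theorem aemeasurable_of_map_eq_probabilityMeasure {α β : Type*} [MeasurableSpace α]
    [MeasurableSpace β] {μ : Measure α} {ν : ProbabilityMeasure β} {ψ : α → β}
    (h : (ν : Measure β) = μ.map ψ) : AEMeasurable ψ μ := by
  by_contra hψ
  rw [Measure.map_of_not_aemeasurable hψ] at h
  exact IsProbabilityMeasure.ne_zero (ν : Measure β) h

/-! ### Uniqueness -/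

/-- Two flow maps coincide if the difference of their velocities at time `t` is controlled by the
supremum over `S` of their distance at time `t`. The two fields need not be equal: for weak
solutions each field depends on the flow itself. -/
theorem IsFlowMap.eq_of_norm_sub_le {k : ℕ} {ε T C : ℝ}
    {X Y : polarDisk k ε → Ico (0 : ℝ) T → Amb k} {S : Set (polarDisk k ε)}
    {Φ Ψ : polarDisk k ε → ℝ → polarDisk k ε} (hΦ : IsFlowMap X S Φ) (hΨ : IsFlowMap Y S Ψ)
    (h : ∀ (t : Ico (0 : ℝ) T) (b : ℝ),
      (∀ x ∈ S, ‖diskVec (Φ x t) - diskVec (Ψ x t)‖ ≤ b) →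
        ∀ x ∈ S, ‖X (Φ x t) t - Y (Ψ x t) t‖ ≤ C * b) :
    ∀ x ∈ S, ∀ t ∈ Ico (0 : ℝ) T, Φ x t = Ψ x t := by
  classical
  let f' : S → ℝ → Amb k := fun x t =>
    if ht : t ∈ Ico (0 : ℝ) T then X (Φ x t) ⟨t, ht⟩ - Y (Ψ x t) ⟨t, ht⟩ else 0
  have key := eq_zero_of_norm_deriv_le_sup (ι := S) (T := T) (B := 2) (C := C)
    (f := fun x t => diskVec (Φ x t) - diskVec (Ψ x t)) (f' := f')
    (fun x => by rw [(hΦ x x.2).1, (hΨ x x.2).1, sub_self])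
    (fun x t _ => (norm_sub_le _ _).trans (by
      rw [norm_diskVec, norm_diskVec]; norm_num))
    (fun x t ht => by
      simp only [f', dif_pos ht]
      exact ((hΦ x x.2).2 ⟨t, ht⟩).sub ((hΨ x x.2).2 ⟨t, ht⟩))
    (fun t ht b hb x => by
      simp only [f', dif_pos ht]
      exact h ⟨t, ht⟩ b (fun y hy => hb ⟨y, hy⟩) x x.2)
  intro x hx t ht
  exact Subtype.ext (Subtype.ext (sub_eq_zero.1 (key ⟨x, hx⟩ t ht)))

/-- The Lipschitz bound of the interaction, averaged over the particles. -/
theorem norm_integral_interaction_sub_le {k : ℕ} {ε C : ℝ} {G : ℝ → ℝ}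
    (hG : Continuous G)
    (hC : ∀ x y x' y' : Amb k, ‖x‖ ≤ 2 → ‖y‖ ≤ 2 → ‖x'‖ ≤ 2 → ‖y'‖ ≤ 2 →
        ‖interaction G x y - interaction G x' y'‖ ≤ C * (‖x - x'‖ + ‖y - y'‖))
    (hC0 : 0 ≤ C)
    {μ : Measure (polarDisk k ε)} [IsProbabilityMeasure μ]
    {φ ψ : polarDisk k ε → polarDisk k ε} (hφ : AEMeasurable φ μ) (hψ : AEMeasurable ψ μ) {b : ℝ}
    (hb : ∀ᵐ y ∂μ, ‖diskVec (φ y) - diskVec (ψ y)‖ ≤ b) (x x' : polarDisk k ε) :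
    ‖(∫ y, interaction G (diskVec x) (diskVec (φ y)) ∂μ) -
        ∫ y, interaction G (diskVec x') (diskVec (ψ y)) ∂μ‖ ≤
      C * (‖diskVec x - diskVec x'‖ + b) := by
  have hint : ∀ (z : polarDisk k ε) {χ : polarDisk k ε → polarDisk k ε}, AEMeasurable χ μ →
      Integrable (fun y => interaction G (diskVec z) (diskVec (χ y))) μ := by
    intro z χ hχ
    refine Integrable.of_bound (((continuous_interaction_diskVec hG z).measurable.comp_aemeasurable
      hχ).aestronglyMeasurable) (‖interaction G (diskVec z) (diskVec z)‖ + C * 2)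
      (Eventually.of_forall fun y => ?_)
    have hx := norm_diskVec z
    have hy := norm_diskVec (χ y)
    have h1 := hC (diskVec z) (diskVec (χ y)) (diskVec z) (diskVec z) (by linarith) (by linarith)
      (by linarith) (by linarith)
    have h2 := norm_sub_le (diskVec (χ y)) (diskVec z)
    have h3 := norm_le_norm_add_norm_sub (interaction G (diskVec z) (diskVec z))
      (interaction G (diskVec z) (diskVec (χ y)))
    rw [norm_sub_rev] at h3
    rw [sub_self, norm_zero, zero_add] at h1
    nlinarith
  rw [← integral_sub (hint x hφ) (hint x' hψ)]
  refine (norm_integral_le_of_norm_le_const (C := C * (‖diskVec x - diskVec x'‖ + b)) ?_).trans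
    (by simp)
  filter_upwards [hb] with y hy
  have h2 : ∀ z : polarDisk k ε, ‖diskVec z‖ ≤ 2 := fun z => by rw [norm_diskVec z]; norm_num
  exact (hC _ _ _ _ (h2 _) (h2 _) (h2 _) (h2 _)).trans (by gcongr)

/-- The velocity field of any curve of measures is Lipschitz in space, so it has at most one flow
map. -/
theorem flowMap_unique {k : ℕ} {ε T : ℝ} {K : Sph k → Sph k → ℝ} {G : ℝ → ℝ} {L : NNReal}
    (hGL : LipschitzWith L G) (hG : IsProfile ε K G)
    {ρ : Ico (0 : ℝ) T → ProbabilityMeasure (polarDisk k ε)} {S : Set (polarDisk k ε)}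
    {Φ Ψ : polarDisk k ε → ℝ → polarDisk k ε} (hΦ : IsFlowMap (velocityField K ρ) S Φ)
    (hΨ : IsFlowMap (velocityField K ρ) S Ψ) :
    ∀ x ∈ S, ∀ t ∈ Ico (0 : ℝ) T, Φ x t = Ψ x t := by
  obtain ⟨C, hC, h, -⟩ := exists_interaction_bound (E := Amb k) hGL
  refine IsFlowMap.eq_of_norm_sub_le (C := C) hΦ hΨ fun t b hb x hx => ?_
  rw [velocityField_eq hG, velocityField_eq hG]
  refine (norm_integral_interaction_sub_le hGL.continuous h hC (b := 0) aemeasurable_id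
    aemeasurable_id (by simp) _ _).trans ?_
  rw [add_zero]
  exact mul_le_mul_of_nonneg_left (hb x hx) hC

/-- Weak solutions from the same initial measure coincide: their flows solve the same coupled
system of equations for the particles in the support. -/
theorem IsWeakSolution.unique {k : ℕ} {ε T : ℝ} {K : Sph k → Sph k → ℝ} {G : ℝ → ℝ} {L : NNReal}
    (hGL : LipschitzWith L G) (hG : IsProfile ε K G) {ρ₀ : ProbabilityMeasure (polarDisk k ε)}
    {ρ ρ' : Ico (0 : ℝ) T → ProbabilityMeasure (polarDisk k ε)}
    (h : IsWeakSolution K ρ₀ ρ) (h' : IsWeakSolution K ρ₀ ρ') (t : Ico (0 : ℝ) T) :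
    ρ t = ρ' t := by
  obtain ⟨Φ, hΦ, -, hρ⟩ := h
  obtain ⟨Ψ, hΨ, -, hρ'⟩ := h'
  obtain ⟨C, hC, hb, -⟩ := exists_interaction_bound (E := Amb k) hGL
  have hae : ∀ᵐ y ∂(ρ₀ : Measure (polarDisk k ε)),
      y ∈ (ρ₀ : Measure (polarDisk k ε)).support := Measure.support_mem_ae
  have heq := IsFlowMap.eq_of_norm_sub_le (C := 2 * C) hΦ hΨ fun t b hbt x hx => by
    have h1 := aemeasurable_of_map_eq_probabilityMeasure (hρ t)
    have h2 := aemeasurable_of_map_eq_probabilityMeasure (hρ' t)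
    rw [velocityField_eq_of_map hG hGL.continuous h1 (hρ t),
      velocityField_eq_of_map hG hGL.continuous h2 (hρ' t)]
    refine (norm_integral_interaction_sub_le hGL.continuous hb hC h1 h2
      (hae.mono fun y hy => hbt y hy) _ _).trans ?_
    have := hbt x hx
    nlinarith
  apply Subtype.ext
  change (ρ t : Measure (polarDisk k ε)) = ρ' t
  rw [hρ t, hρ' t]
  exact Measure.map_congr (hae.mono fun y hy => heq y hy t t.2)

/-! ### Existence -/

/-- A compact subset of the disk keeps a positive distance from its boundary. -/
theorem exists_inner_northPole_ge {k : ℕ} {ε : ℝ} (hε : 0 < ε) (hε' : ε < Real.pi / 2)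
    {S : Set (polarDisk k ε)} (hS : IsCompact S) :
    ∃ η : ℝ, 0 < η ∧ ∀ x ∈ S, Real.sin ε + η ≤ inner ℝ (diskVec x) (northPole k : Amb k) := by
  rcases S.eq_empty_or_nonempty with rfl | hne
  · exact ⟨1, one_pos, by simp⟩
  · have hc : Continuous fun x : polarDisk k ε => inner ℝ (diskVec x) (northPole k : Amb k) :=
      continuous_diskVec.inner continuous_const
    obtain ⟨x₀, -, hmin⟩ := hS.exists_isMinOn hne hc.continuousOn
    have h0 : Real.sin ε < inner ℝ (diskVec x₀) (northPole k : Amb k) :=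
      (mem_polarDisk_iff hε hε' x₀.1).1 (Subtype.prop x₀)
    refine ⟨_, sub_pos.2 h0, fun x hx => ?_⟩
    have : inner ℝ (diskVec x₀) (northPole k : Amb k) ≤ inner ℝ (diskVec x) (northPole k : Amb k) :=
      hmin hx
    linarith

/-- The sphere is invariant: since the radial component of the interaction is proportional to
`‖x‖² - 1`, this quantity satisfies a linear differential inequality along every trajectory. -/
theorem norm_eq_one_of_hasDerivWithinAt {E S : Type*} [NormedAddCommGroup E]
    [InnerProductSpace ℝ E] [CompleteSpace E] [MeasurableSpace S] {μ : Measure S}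
    [IsProbabilityMeasure μ] {V : E → E → E} {C T : ℝ} (hC : 0 ≤ C)
    (hVC : ∀ x y : E, ‖x‖ ≤ 2 → ‖y‖ ≤ 2 → |inner ℝ x (V x y)| ≤ C * |‖x‖ ^ 2 - 1|)
    {X : S → ℝ → E} (hX2 : ∀ t ∈ Ico 0 T, ∀ x, ‖X x t‖ ≤ 2) (hX0 : ∀ x, ‖X x 0‖ = 1)
    (hint : ∀ t ∈ Ico 0 T, ∀ x, Integrable (fun y => V (X x t) (X y t)) μ)
    (hX : ∀ t ∈ Ico 0 T, ∀ x, HasDerivWithinAt (X x) (∫ y, V (X x t) (X y t) ∂μ) (Ico 0 T) t) :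
    ∀ x, ∀ t ∈ Ico 0 T, ‖X x t‖ = 1 := by
  have key : ∀ x, ∀ t ∈ Ico 0 T, ‖X x t‖ ^ 2 - 1 = 0 := by
    intro x t ht
    refine eq_zero_of_norm_deriv_le_sup (ι := Unit) (C := 2 * C) (B := 4) (T := T)
      (f := fun _ t => ‖X x t‖ ^ 2 - 1)
      (f' := fun _ t => 2 * inner ℝ (X x t) (∫ y, V (X x t) (X y t) ∂μ))
      (fun _ => by simp [hX0]) (fun _ t ht => ?_) (fun _ t ht => ?_) (fun t ht b hb _ => ?_) () t ht
    · have h2 := hX2 t ht x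
      have h0 := norm_nonneg (X x t)
      rw [Real.norm_eq_abs, abs_le]
      constructor <;> nlinarith
    · exact (hX t ht x).norm_sq.sub_const 1
    · rw [← integral_inner (hint t ht x), norm_mul, Real.norm_two, mul_assoc]
      refine mul_le_mul_of_nonneg_left ?_ zero_le_two
      refine (norm_integral_le_of_norm_le_const (C := C * ‖‖X x t‖ ^ 2 - 1‖)
        (Eventually.of_forall fun y => ?_)).trans ?_
      · exact hVC _ _ (hX2 t ht x) (hX2 t ht y)
      · rw [probReal_univ, mul_one]
        exact mul_le_mul_of_nonneg_left (hb ()) hC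
  intro x t ht
  have h := key x t ht
  have h0 := norm_nonneg (X x t)
  nlinarith

/-- Short-time existence: transport `ρ₀` by the flow of particles started on its support. The flow
stays on the sphere, and it stays in the disk for a short time because the support is compact. -/
theorem exists_weakSolution {k : ℕ} {ε : ℝ} (hε : 0 < ε) (hε' : ε < Real.pi / 2)
    {K : Sph k → Sph k → ℝ} {G : ℝ → ℝ} {L : NNReal}
    (hGL : LipschitzWith L G) (hG : IsProfile ε K G) (ρ₀ : ProbabilityMeasure (polarDisk k ε))
    (hρ₀ : IsCompact (ρ₀ : Measure (polarDisk k ε)).support) :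
    ∃ T : ℝ, 0 < T ∧
      ∃ ρ : C(Ico (0 : ℝ) T, ProbabilityMeasure (polarDisk k ε)), IsWeakSolution K ρ₀ ρ := by
  classical
  set S : Set (polarDisk k ε) := (ρ₀ : Measure (polarDisk k ε)).support with hS
  have : CompactSpace S := isCompact_iff_compactSpace.1 hρ₀
  have hSm : MeasurableSet S := Measure.isClosed_support.measurableSet
  have hae : ∀ᵐ y ∂(ρ₀ : Measure (polarDisk k ε)), y ∈ S := Measure.support_mem_ae
  have hres : (ρ₀ : Measure (polarDisk k ε)).restrict S = ρ₀ :=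
    Measure.restrict_eq_self_of_ae_mem hae
  set μ : Measure S := (ρ₀ : Measure (polarDisk k ε)).comap Subtype.val with hμ
  have hμp : IsProbabilityMeasure μ :=
    (MeasurableEmbedding.subtype_coe hSm).isProbabilityMeasure_comap (by simpa using hae)
  obtain ⟨C, hC, hb, hbr⟩ := exists_interaction_bound (E := Amb k) hGL
  obtain ⟨η, hη, hpole⟩ := exists_inner_northPole_ge hε hε' hρ₀
  let X₀ : C(S, Amb k) := ⟨fun x => diskVec x.1, continuous_diskVec.comp continuous_subtype_val⟩
  obtain ⟨T, hT, X, hX0, hXn, hX⟩ := exists_meanField_flow μ (continuous_interaction hGL.continuous)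
    hC hb X₀ (fun x => (norm_diskVec x.1).le) (lt_min hη one_pos)
  have hX2 : ∀ t ∈ Ico 0 T, ∀ x, ‖X t x‖ ≤ 2 := by
    intro t ht x
    have h1 := (hXn t ht x).trans_le (min_le_right _ _)
    have h2 := norm_le_norm_add_norm_sub (X₀ x) (X t x)
    have h3 : ‖X₀ x‖ = 1 := norm_diskVec x.1
    rw [norm_sub_rev] at h2
    linarith
  have hX1 : ∀ x, ∀ t ∈ Ico 0 T, ‖X t x‖ = 1 :=
    norm_eq_one_of_hasDerivWithinAt (X := fun x t => X t x) hC hbr hX2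
      (fun x => by rw [hX0]; exact norm_diskVec x.1)
      (fun t _ x => integrable_meanField μ (continuous_interaction hGL.continuous) (X t) x) hX
  have hXS : ∀ x, ∀ t ∈ Ico 0 T, X t x ∈ Metric.sphere (0 : Amb k) 1 := fun x t ht =>
    mem_sphere_zero_iff_norm.2 (hX1 x t ht)
  have hXD : ∀ x, ∀ t (ht : t ∈ Ico 0 T), (⟨X t x, hXS x t ht⟩ : Sph k) ∈ polarDisk k ε := by
    intro x t ht
    rw [mem_polarDisk_iff hε hε']
    have h1 := (hXn t ht x).trans_le (min_le_left _ _)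
    have h2 := hpole x.1 x.2
    have h3 := norm_inner_le_norm (𝕜 := ℝ) (X t x - X₀ x) (northPole k : Amb k)
    rw [norm_eq_of_mem_sphere, mul_one, Real.norm_eq_abs, inner_sub_left] at h3
    have h4 := (abs_le.1 h3).1
    have h5 : inner ℝ (X₀ x) (northPole k : Amb k) =
      inner ℝ (diskVec x.1) (northPole k : Amb k) := rfl
    change Real.sin ε < inner ℝ (X t x) (northPole k : Amb k)
    linarith
  -- Off the support the flow map has no role; the identity keeps `Ψ` with values in the disk.
  let Ψ : polarDisk k ε → ℝ → polarDisk k ε := fun x t =>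
    if h : x ∈ S ∧ t ∈ Ico 0 T then ⟨⟨X t ⟨x, h.1⟩, hXS _ t h.2⟩, hXD _ t h.2⟩ else x
  have hΨ : ∀ x (hx : x ∈ S), ∀ t ∈ Ico 0 T, diskVec (Ψ x t) = X t ⟨x, hx⟩ := by
    intro x hx t ht
    simp only [Ψ, dif_pos (And.intro hx ht)]
  have hind : IsInducing (diskVec : polarDisk k ε → Amb k) :=
    IsInducing.subtypeVal.comp IsInducing.subtypeVal
  have hΨm : ∀ t ∈ Ico 0 T, AEMeasurable (fun x => Ψ x t) (ρ₀ : Measure (polarDisk k ε)) := by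
    intro t ht
    have hcont : ContinuousOn (fun x => Ψ x t) S := by
      rw [continuousOn_iff_continuous_domRestrict, hind.continuous_iff]
      refine (X t).continuous.congr fun x => ?_
      exact (hΨ x.1 x.2 t ht).symm
    have := hcont.aemeasurable (μ := (ρ₀ : Measure (polarDisk k ε))) hSm
    rwa [hres] at this
  have hΨt : ∀ x ∈ S, Continuous fun t : Ico (0 : ℝ) T => Ψ x t := by
    intro x hx
    rw [hind.continuous_iff]
    have h1 : ContinuousOn (fun t => X t ⟨x, hx⟩) (Ico 0 T) := fun t ht =>
      (hX t ht ⟨x, hx⟩).continuousWithinAt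
    refine (continuousOn_iff_continuous_domRestrict.1 h1).congr fun t => ?_
    exact (hΨ x hx t t.2).symm
  let ρ : C(Ico (0 : ℝ) T, ProbabilityMeasure (polarDisk k ε)) :=
    ⟨fun t => ρ₀.map (hΨm t t.2), by
      rw [ProbabilityMeasure.continuous_iff_forall_continuous_integral]
      intro f
      have h1 : ∀ t : Ico (0 : ℝ) T,
          ∫ y, f y ∂((ρ₀.map (hΨm t t.2) : ProbabilityMeasure (polarDisk k ε)) :
            Measure (polarDisk k ε)) = ∫ x, f (Ψ x t) ∂(ρ₀ : Measure (polarDisk k ε)) := fun t => by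
        rw [ProbabilityMeasure.toMeasure_map]
        exact integral_map (hΨm t t.2) f.continuous.aestronglyMeasurable
      simp only [h1]
      refine continuous_of_dominated (bound := fun _ => ‖f‖)
        (fun t => (f.continuous.measurable.comp_aemeasurable (hΨm t t.2)).aestronglyMeasurable)
        (fun t => Eventually.of_forall fun x => f.norm_coe_le_norm _) (integrable_const _) ?_
      exact hae.mono fun x hx => f.continuous.comp (hΨt x hx)⟩
  have hρ : ∀ t : Ico (0 : ℝ) T, (ρ t : Measure (polarDisk k ε)) =
      (ρ₀ : Measure (polarDisk k ε)).map (fun x => Ψ x t) := fun t =>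
    ProbabilityMeasure.toMeasure_map _ (hΨm t t.2)
  have hflow : IsFlowMap (velocityField K ρ) S Ψ := by
    intro x hx
    refine ⟨?_, fun t => ?_⟩
    · refine Subtype.ext (Subtype.ext ?_)
      change diskVec (Ψ x 0) = diskVec x
      rw [hΨ x hx 0 ⟨le_rfl, hT⟩, hX0]
      rfl
    · have h1 : velocityField K ρ (Ψ x t) t =
          ∫ y, interaction G (X t ⟨x, hx⟩) (X t y) ∂μ := by
        rw [velocityField_eq_of_map hG hGL.continuous (hΨm t t.2) (hρ t), hΨ x hx t t.2]
        nth_rw 1 [← hres]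
        rw [← integral_subtype_comap hSm]
        exact integral_congr_ae (Eventually.of_forall fun y => by
          simp only [hΨ y.1 y.2 t t.2])
      rw [h1]
      exact (hX t t.2 ⟨x, hx⟩).congr (fun s hs => hΨ x hx s hs) (hΨ x hx t t.2)
  exact ⟨T, hT, ρ, Ψ, hflow, fun Φ hΦ => flowMap_unique hGL hG hΦ hflow, hρ⟩

end

theorem mainTheorem1 (k : ℕ) (ε : ℝ) (hε : 0 < ε) (hε' : ε < Real.pi / 2)
    (K : Sph k → Sph k → ℝ) (hK : IsIntrinsicPotential K)
    (ρ₀ : ProbabilityMeasure (polarDisk k ε))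
    (hρ₀ : IsCompact (ρ₀ : Measure (polarDisk k ε)).support) :
    ∃ T : ℝ, 0 < T ∧
      ∃! ρ : C(Ico (0 : ℝ) T, ProbabilityMeasure (polarDisk k ε)), IsWeakSolution K ρ₀ ρ := by
  obtain ⟨G, L, hGL, hG⟩ := hK.exists_isProfile hε hε'
  obtain ⟨T, hT, ρ, hρ⟩ := exists_weakSolution hε hε' hGL hG ρ₀ hρ₀
  exact ⟨T, hT, ρ, hρ, fun ρ' hρ' => ContinuousMap.ext fun t => hρ'.unique hGL hG hρ t⟩
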